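/- Let $\Bbbk$ be an algebraically closed field of characteristic zero, and let $h(x)\in\Bbbk[x]$ be monic of degree $N\ge 2$ with zero coefficient of $x^{N-1}$ (this is no loss of generality up to isomorphism of the algebra below). Let $A_h$ be the $\Bbbk$-algebra generated by $x$ and $t$ subject to $tx=xt+h(x)$. For $r(x)\in\Bbbk[x]$ let $\sigma_{r}\in\operatorname{Aut}(A_h)$ be given by $\sigma_r(x)=x$, $\sigma_r(t)=t+r(x)$, and for $a$ in $\tau_{\mathbb P}:=\{a\in\Bbbk^*: h(ax)=a^Nh(x)\}$ let $\tau_a\in\operatorname{Aut}(A_h)$ be given by $\tau_a(x)=ax$, $\tau_a(t)=a^{N-1}t$. For a subgroup $G\subseteq\tau_{\mathbb P}$ write $\Bbbk[x]\rtimes G:=\{\sigma_r\circ\tau_a : r\in\Bbbk[x],\ a\in G\}$, a subgroup of $\operatorname{Aut}(A_h)$, and let $\mathbb G_n=\{a\in\Bbbk: a^n=1\}$ for $n\ge1$. Let $w\in A_h\setminus\Bbbk$, let $s(x)\in\Bbbk[x]$ with $\deg s<\deg h$ (where $\deg 0=-\infty$), let $\Delta_{s(x)}$ be the $\Bbbk$-derivation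 of $A_h$ with $\Delta_{s(x)}(x)=0$ and $\Delta_{s(x)}(t)=s(x)$, let $ad_w(u)=wu-uw$, and put $D=ad_w+\Delta_{s(x)}$. Let $\operatorname{Aut}_D(A_h)=\{\rho\in\operatorname{Aut}(A_h):\rho D=D\rho\}$ be the isotropy group of $D$. Then: 1. there is an integer $n\ge 1$ such that $\mathbb G_n\subseteq\tau_{\mathbb P}$ and $\operatorname{Aut}_D(A_h)\subseteq\Bbbk[x]\rtimes\mathbb G_n$; 2. the multiplicative part $\{a\in\tau_{\mathbb P}: \sigma_r\circ\tau_a\in\operatorname{Aut}_D(A_h)\text{ for some } r\in\Bbbk[x]\}$ of the isotropy group is finite; 3. if $h(x)=x^N$ (so that $\tau_{\mathbb P}=\Bbbk^*$), then $\operatorname{Aut}_D(A_h)\subsetneq\operatorname{Aut}(A_h)$. -/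

import Mathlib

open Polynomial

namespace DiffOre

noncomputable section

universe u v

section General

variable (k : Type u) [Field k] (R : Type v) [Ring R] [Algebra k R]

/-- `Der(R)`: the `k`-linear derivations of a (not necessarily commutative) `k`-algebra `R`. -/
def Der : Submodule k (R →ₗ[k] R) where
  carrier := {D | ∀ u v, D (u * v) = u * D v + D u * v}
  zero_mem' := by intro u v; simp
  add_mem' := by
    intro D E hD hE u v
    simp only [LinearMap.add_apply, hD u v, hE u v, mul_add, add_mul]
    abel
  smul_mem' := by
    intro c D hD u v
    simp only [LinearMap.smul_apply, hD u v, smul_add, mul_smul_comm, smul_mul_assoc]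

variable {k R}

/-- The inner derivation `ad_w = [w, -]`. -/
def ad (w : R) : Der k R :=
  ⟨LinearMap.mulLeft k w - LinearMap.mulRight k w, by
    intro u v
    simp only [LinearMap.sub_apply, LinearMap.mulLeft_apply, LinearMap.mulRight_apply]
    noncomm_ring⟩

theorem ad_apply (w u : R) : (ad w : Der k R).1 u = w * u - u * w := rfl

/-- The isotropy subgroup `Aut_D(R) = {ρ ∈ Aut(R) | ρ D = D ρ}`. -/
def isotropy (D : Der k R) : Subgroup (R ≃ₐ[k] R) where
  carrier := {ρ | ∀ u, ρ (D.1 u) = D.1 (ρ u)}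
  one_mem' := by intro u; rfl
  mul_mem' := by
    intro a b ha hb u
    simp only [AlgEquiv.mul_apply]
    rw [hb u, ha]
  inv_mem' := by
    intro a ha u
    apply a.injective
    rw [ha]
    simp only [← AlgEquiv.mul_apply, mul_inv_cancel, AlgEquiv.one_apply]

end General

variable {k : Type u} [Field k]

/-- The defining relation `t x = x t + h(x)`; the free generators are `x = ι 0` and `t = ι 1`. -/
inductive Rel (h : k[X]) : FreeAlgebra k (Fin 2) → FreeAlgebra k (Fin 2) → Prop
  | comm : Rel h (FreeAlgebra.ι k 1 * FreeAlgebra.ι k 0)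
      (FreeAlgebra.ι k 0 * FreeAlgebra.ι k 1 + aeval (FreeAlgebra.ι k (0 : Fin 2)) h)

/-- The algebra `A_h`: generated by `x` and `t` subject to `t x = x t + h(x)`. -/
def A (h : k[X]) : Type u := RingQuot (Rel h)

instance (h : k[X]) : Ring (A h) := inferInstanceAs (Ring (RingQuot (Rel h)))

instance (h : k[X]) : Algebra k (A h) := inferInstanceAs (Algebra k (RingQuot (Rel h)))

namespace A

/-- The quotient map from the free algebra. -/
def mk (h : k[X]) : FreeAlgebra k (Fin 2) →ₐ[k] A h := RingQuot.mkAlgHom k (Rel h)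

/-- The generator `x` of `A_h`. -/
def x (h : k[X]) : A h := mk h (FreeAlgebra.ι k 0)

/-- The generator `t` of `A_h`. -/
def t (h : k[X]) : A h := mk h (FreeAlgebra.ι k 1)

theorem t_mul_x (h : k[X]) : t h * x h = x h * t h + aeval (x h) h := by
  have := RingQuot.mkAlgHom_rel k (Rel.comm (h := h))
  change mk h _ = mk h _ at this
  rw [map_mul, map_add, map_mul, ← aeval_algHom_apply] at this
  exact this

section Lift

variable {B : Type*} [Ring B] [Algebra k B]

/-- The universal property of `A_h`. -/
def lift (h : k[X]) (X₀ T₀ : B) (H : T₀ * X₀ = X₀ * T₀ + aeval X₀ h) : A h →ₐ[k] B :=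
  RingQuot.liftAlgHom k ⟨FreeAlgebra.lift k ![X₀, T₀], by
    rintro _ _ ⟨⟩
    rw [map_mul, map_add, map_mul, ← aeval_algHom_apply]
    simpa using H⟩

@[simp] theorem lift_x (h : k[X]) (X₀ T₀ : B) (H) : lift h X₀ T₀ H (x h) = X₀ := by
  simp only [lift, x, mk]
  erw [RingQuot.liftAlgHom_mkAlgHom_apply]
  simp

@[simp] theorem lift_t (h : k[X]) (X₀ T₀ : B) (H) : lift h X₀ T₀ H (t h) = T₀ := by
  simp only [lift, t, mk]
  erw [RingQuot.liftAlgHom_mkAlgHom_apply]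
  simp

theorem hom_ext {h : k[X]} {f g : A h →ₐ[k] B} (hx : f (x h) = g (x h)) (ht : f (t h) = g (t h)) :
    f = g := by
  refine RingQuot.ringQuot_ext' k f g (FreeAlgebra.hom_ext ?_)
  funext i
  fin_cases i
  · exact hx
  · exact ht

theorem equiv_ext {h : k[X]} {f g : A h ≃ₐ[k] A h} (hx : f (x h) = g (x h))
    (ht : f (t h) = g (t h)) : f = g := by
  have : (f : A h →ₐ[k] A h) = g := hom_ext hx ht
  exact AlgEquiv.ext fun u => DFunLike.congr_fun this u

end Lift

end A

open A

/-- The elements `x` and `p(x)` of `A_h` commute. -/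
theorem aeval_mul_x (h p : k[X]) : aeval (x h) p * x h = x h * aeval (x h) p := by
  conv_lhs => rw [← aeval_X (R := k) (x h), aeval_X (R := k)]
  have : aeval (x h) (p * X) = aeval (x h) (X * p) := by rw [mul_comm]
  simpa using this

/-- The homomorphism `u ↦ u + ε Δ_s(u)` from `A_h` to the dual numbers over `A_h`. -/
def deltaHom (h s : k[X]) : A h →ₐ[k] TrivSqZeroExt (A h) (A h) :=
  A.lift h (TrivSqZeroExt.inl (x h))
    (TrivSqZeroExt.inl (t h) + TrivSqZeroExt.inr (aeval (x h) s)) (by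
      have e : aeval (TrivSqZeroExt.inl (x h) : TrivSqZeroExt (A h) (A h)) h
          = TrivSqZeroExt.inl (aeval (x h) h) :=
        aeval_algHom_apply (TrivSqZeroExt.inlAlgHom k (A h) (A h)) (x h) h
      rw [e]
      ext
      · simp [t_mul_x]
      · simp [aeval_mul_x])

theorem fst_deltaHom (h s : k[X]) (u : A h) : (deltaHom h s u).fst = u := by
  have : (TrivSqZeroExt.fstHom k (A h) (A h)).comp (deltaHom h s) = AlgHom.id k (A h) := by
    apply A.hom_ext <;> simp [deltaHom]
  exact DFunLike.congr_fun this u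

/-- The derivation `Δ_s` of `A_h` with `Δ_s(x) = 0` and `Δ_s(t) = s(x)`. -/
def delta (h s : k[X]) : Der k (A h) :=
  ⟨(TrivSqZeroExt.sndHom (A h) (A h)).restrictScalars k ∘ₗ (deltaHom h s).toLinearMap, by
    intro u v
    simp [fst_deltaHom]⟩

theorem delta_x (h s : k[X]) : (delta h s).1 (x h) = 0 := by simp [delta, deltaHom]

theorem delta_t (h s : k[X]) : (delta h s).1 (t h) = aeval (x h) s := by simp [delta, deltaHom]

/-- The endomorphism `x ↦ x`, `t ↦ t + r(x)`. -/
def sigmaHom (h r : k[X]) : A h →ₐ[k] A h :=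
  A.lift h (x h) (t h + aeval (x h) r) (by rw [add_mul, mul_add, t_mul_x, aeval_mul_x]; abel)

theorem sigmaHom_aeval (h r p : k[X]) : sigmaHom h r (aeval (x h) p) = aeval (x h) p := by
  rw [← aeval_algHom_apply]; simp [sigmaHom]

theorem sigmaHom_comp (h r r' : k[X]) (u : A h) :
    sigmaHom h r (sigmaHom h r' u) = sigmaHom h (r + r') u := by
  have : (sigmaHom h r).comp (sigmaHom h r') = sigmaHom h (r + r') := by
    apply A.hom_ext
    · simp [sigmaHom]
    · have e : ∀ r, sigmaHom h r (t h) = t h + aeval (x h) r := fun r => by simp [sigmaHom]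
      rw [AlgHom.comp_apply, e, map_add, e, sigmaHom_aeval, e, map_add]
      abel
  exact DFunLike.congr_fun this u

theorem sigmaHom_zero (h : k[X]) (u : A h) : sigmaHom h 0 u = u := by
  have : sigmaHom h 0 = AlgHom.id k (A h) := by apply A.hom_ext <;> simp [sigmaHom]
  exact DFunLike.congr_fun this u

/-- The group homomorphism `r ↦ σ_r` from `(k[x], +)` to `Aut(A_h)`,
where `σ_r(x) = x` and `σ_r(t) = t + r(x)`. -/
def sigma (h : k[X]) : Multiplicative k[X] →* (A h ≃ₐ[k] A h) where
  toFun r := AlgEquiv.ofAlgHom (sigmaHom h r.toAdd) (sigmaHom h (-r.toAdd))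
    (by ext u; simp [sigmaHom_comp, sigmaHom_zero]) (by ext u; simp [sigmaHom_comp, sigmaHom_zero])
  map_one' := by ext u; simp [sigmaHom_zero]
  map_mul' r r' := by ext u; simp [sigmaHom_comp]

theorem sigma_x (h r : k[X]) : sigma h (.ofAdd r) (x h) = x h := by simp [sigma, sigmaHom]

theorem sigma_t (h r : k[X]) : sigma h (.ofAdd r) (t h) = t h + aeval (x h) r := by
  simp [sigma, sigmaHom]

theorem comp_scale (p : k[X]) (a b : k) :
    (p.comp (C a * X)).comp (C b * X) = p.comp (C (a * b) * X) := by
  rw [comp_assoc]; simp [mul_assoc]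

/-- The group of all `a ∈ k^*` with `h(ax) = a^N h(x)`, where `N = deg h`. -/
def scaling (h : k[X]) : Subgroup kˣ where
  carrier := {a | h.comp (C (a : k) * X) = C ((a : k) ^ h.natDegree) * h}
  one_mem' := by simp
  mul_mem' := by
    intro a b ha hb
    simp only [Set.mem_ofPred_eq] at ha hb ⊢
    rw [Units.val_mul, ← comp_scale, ha, mul_comp, hb, C_comp, mul_pow, C_mul, mul_assoc]
  inv_mem' := by
    intro a ha
    simp only [Set.mem_ofPred_eq] at ha ⊢
    have h1 : (C ((a : k) ^ h.natDegree) * h).comp (C ((a⁻¹ : kˣ) : k) * X) = h := by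
      rw [← ha, comp_scale]; simp
    rw [mul_comp, C_comp] at h1
    calc h.comp (C ((a⁻¹ : kˣ) : k) * X)
        = C (((a⁻¹ : kˣ) : k) ^ h.natDegree) *
            (C ((a : k) ^ h.natDegree) * h.comp (C ((a⁻¹ : kˣ) : k) * X)) := by
          rw [← mul_assoc, ← C_mul, ← mul_pow]; simp
      _ = _ := by rw [h1]

/-- The endomorphism `x ↦ a x`, `t ↦ a^(N-1) t`. -/
def tauHom (h : k[X]) (a : scaling h) : A h →ₐ[k] A h :=
  A.lift h ((a : kˣ) • x h) (((a : kˣ) ^ ((h.natDegree : ℤ) - 1)) • t h) (by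
    have ha : h.comp (C ((a : kˣ) : k) * X) = C (((a : kˣ) : k) ^ h.natDegree) * h := a.2
    have e : aeval ((a : kˣ) • x h) h = ((a : kˣ) ^ (h.natDegree : ℤ)) • aeval (x h) h := by
      have := congrArg (aeval (x h)) ha
      simp only [aeval_comp, map_mul, aeval_C, aeval_X, ← Algebra.smul_def] at this
      simpa [Units.smul_def] using this
    rw [e, smul_mul_smul_comm, smul_mul_smul_comm, t_mul_x, smul_add, ← zpow_add_one,
      ← zpow_one_add, sub_add_cancel, add_sub_cancel])

theorem tauHom_x (h : k[X]) (a : scaling h) : tauHom h a (x h) = (a : kˣ) • x h := by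
  simp [tauHom]

theorem tauHom_t (h : k[X]) (a : scaling h) :
    tauHom h a (t h) = ((a : kˣ) ^ ((h.natDegree : ℤ) - 1)) • t h := by
  simp [tauHom]

theorem tauHom_comp (h : k[X]) (a b : scaling h) (u : A h) :
    tauHom h a (tauHom h b u) = tauHom h (a * b) u := by
  have : (tauHom h a).comp (tauHom h b) = tauHom h (a * b) := by
    apply A.hom_ext
    · simp [tauHom_x, Units.smul_def, smul_smul, mul_comm]
    · rw [AlgHom.comp_apply, tauHom_t, tauHom_t, Units.smul_def, map_smul, tauHom_t,
        ← Units.smul_def, smul_smul, Subgroup.coe_mul, mul_zpow, mul_comm]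
  exact DFunLike.congr_fun this u

theorem tauHom_one (h : k[X]) (u : A h) : tauHom h 1 u = u := by
  have : tauHom h 1 = AlgHom.id k (A h) := by apply A.hom_ext <;> simp [tauHom]
  exact DFunLike.congr_fun this u

/-- The group homomorphism `a ↦ τ_a`, where `τ_a(x) = a x` and `τ_a(t) = a^(N-1) t`. -/
def tau (h : k[X]) : scaling h →* (A h ≃ₐ[k] A h) where
  toFun a := AlgEquiv.ofAlgHom (tauHom h a) (tauHom h a⁻¹)
    (by ext u; simp [tauHom_comp, tauHom_one]) (by ext u; simp [tauHom_comp, tauHom_one])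
  map_one' := by ext u; simp [tauHom_one]
  map_mul' a b := by ext u; simp [tauHom_comp]

theorem tau_x (h : k[X]) (a : scaling h) : tau h a (x h) = (a : kˣ) • x h := tauHom_x h a

theorem tau_t (h : k[X]) (a : scaling h) :
    tau h a (t h) = ((a : kˣ) ^ ((h.natDegree : ℤ) - 1)) • t h := tauHom_t h a

/-- The polynomial `a^(1-N) r(ax)`. -/
def twist (N : ℕ) (a : kˣ) (r : k[X]) : k[X] :=
  C ((a ^ (1 - (N : ℤ)) : kˣ) : k) * r.comp (C (a : k) * X)

theorem twist_twist (N : ℕ) (a b : kˣ) (r : k[X]) :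
    twist N a (twist N b r) = twist N (a * b) r := by
  simp only [twist, mul_comp, C_comp, comp_scale]
  rw [← mul_assoc, ← C_mul, ← Units.val_mul, ← mul_zpow, Units.val_mul, mul_comm (b : k)]

theorem twist_one (N : ℕ) (r : k[X]) : twist N 1 r = r := by simp [twist]

theorem twist_add (N : ℕ) (a : kˣ) (r r' : k[X]) :
    twist N a (r + r') = twist N a r + twist N a r' := by
  simp [twist, mul_add]

/-- The action of the group of scalars on `(k[x], +)`, where `a` sends `r(x)` to `a^(1-N) r(ax)`. -/
def action (h : k[X]) : scaling h →* MulAut (Multiplicative k[X]) where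
  toFun a :=
    { toFun := fun r => .ofAdd (twist h.natDegree a r.toAdd)
      invFun := fun r => .ofAdd (twist h.natDegree (a : kˣ)⁻¹ r.toAdd)
      left_inv := fun r => by simp [twist_twist, twist_one]
      right_inv := fun r => by simp [twist_twist, twist_one]
      map_mul' := fun r r' => by simp [twist_add] }
  map_one' := by ext r : 1; simp [twist_one]
  map_mul' a b := by ext r : 1; simp [twist_twist]

/-- The homomorphism `(r, a) ↦ σ_r ∘ τ_a` from the semidirect product of `(k[x], +)` by
`{a | h(ax) = a^N h(x)}` to `Aut(A_h)`. -/
def toAut (h : k[X]) : Multiplicative k[X] ⋊[action h] scaling h →* (A h ≃ₐ[k] A h) :=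
  SemidirectProduct.lift (sigma h) (tau h) (by
    intro a
    refine MonoidHom.ext fun r => ?_
    have key : ∀ r : k[X], sigma h (.ofAdd (twist h.natDegree a r)) * tau h a
        = tau h a * sigma h (.ofAdd r) := by
      intro r
      apply A.equiv_ext
      · simp only [AlgEquiv.mul_apply, tau_x, sigma_x, Units.smul_def, map_smul]
      · simp only [AlgEquiv.mul_apply, tau_t, sigma_t, Units.smul_def, map_smul, map_add]
        rw [smul_add]
        congr 1
        have e : tau h a (aeval (x h) r) = aeval (tau h a (x h)) r :=
          (aeval_algHom_apply (tau h a : A h →ₐ[k] A h) (x h) r).symm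
        rw [e, tau_x, twist, map_mul, aeval_C, ← Algebra.smul_def, smul_smul, ← Units.val_mul,
          ← zpow_add]
        simp [aeval_comp, Units.smul_def, Algebra.smul_def]
    have := key r.toAdd
    simp only [MonoidHom.comp_apply, MulEquiv.coe_toMonoidHom, MulAut.conj_apply]
    rw [eq_mul_inv_iff_mul_eq]
    exact this)

theorem toAut_apply (h r : k[X]) (a : scaling h) (u : A h) :
    toAut h ⟨.ofAdd r, a⟩ u = sigma h (.ofAdd r) (tau h a u) := rfl

/-- `k[x] ⋊ G` as a subgroup of `Aut(A_h)`: all `σ_r ∘ τ_a` with `r ∈ k[x]` and `a ∈ G`.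
It is used for subgroups `G` of `k^*` such that `h(ax) = a^N h(x)` for all `a ∈ G`. -/
def polyRtimes (h : k[X]) (G : Subgroup kˣ) : Subgroup (A h ≃ₐ[k] A h) :=
  ((G.subgroupOf (scaling h)).comap SemidirectProduct.rightHom).map (toAut h)

theorem mem_polyRtimes (h : k[X]) (G : Subgroup kˣ) (ρ : A h ≃ₐ[k] A h) :
    ρ ∈ polyRtimes h G ↔
      ∃ (r : k[X]) (a : scaling h), (a : kˣ) ∈ G ∧ ρ = sigma h (.ofAdd r) * tau h a := by
  constructor
  · rintro ⟨g, hg, rfl⟩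
    exact ⟨g.left.toAdd, g.right, hg, rfl⟩
  · rintro ⟨r, a, ha, rfl⟩
    exact ⟨⟨.ofAdd r, a⟩, ha, rfl⟩

/-- The multiplicative part of a subgroup `H` of `Aut(A_h)`: the group of all scalars `a` such that
`σ_r ∘ τ_a ∈ H` for some `r ∈ k[x]`. -/
def multiplicativePart (h : k[X]) (H : Subgroup (A h ≃ₐ[k] A h)) : Subgroup (scaling h) :=
  (H.comap (toAut h)).map SemidirectProduct.rightHom

end

end DiffOre

/-!
Every element of `A_h` has a normal form `∑ pᵢ(x) tⁱ`. Its coefficients are read off from an action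
of `A_h` on `k[x][Y]` in which `x` acts by multiplication and `t` by `Y + h d/dx`: evaluating at `1`
gives `toPoly`, and `ofPoly_toPoly` recovers the element. For this normal form leading terms
multiply (`natDegree_coeff_mul`), so `A_h` is a domain whose units are scalars, and in characteristic
zero the centralizer of `x` is `k[x]` (`exists_eq_aeval_of_commute`).

All commutators lie in `h A_h`, and `h` is itself the commutator of `t` and `x`; hence an
automorphism `ρ` sends `h` to `c h` with `c` a nonzero scalar. As `h(ρ(x)) = c h(x)`, the element
`ρ(x)` is a polynomial of degree one in `x`, and the vanishing coefficient of `h` makes it a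
multiple `a x`. Then `ρ(t) - a^(N-1) t` commutes with `x`, so it lies in `k[x]`. Thus every
automorphism is some `σ_r ∘ τ_a` (`exists_eq_sigma_mul_tau`).

If `ρ = σ_r ∘ τ_a` commutes with `D = ad_w + Δ_s`, then `ρ(w) - w` commutes with `x`, so it is some
`f(x)`. Evaluating on `t` shows that `h f'` has degree less than `h`, because `s` does, so `f` is
constant (`exists_map_eq_add_of_mem_isotropy`). Let `p(x) t^d` be the leading term of `w` and `m`
the degree of `p`. As `w` is not constant, comparing the leading terms of `ρ(w)` and `w` gives
`a^(m + (N-1) d) = 1` with a positive exponent (`exists_pow_eq_one`).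

For `h = x^N` this exponent is the required `n`. Otherwise comparing two coefficients of `h` shows
that the group of all admissible scalars is finite, hence equal to a group of roots of unity
(`exists_scaling_eq_rootsOfUnity`).
-/

namespace DiffOre

noncomputable section

variable {k : Type u} [Field k]

/-! ### Normal forms -/

/-- The `k`-linear map `∑ pᵢ Yⁱ ↦ ∑ h pᵢ' Yⁱ` of `k[x][Y]`. -/
def coeffDeriv (h : k[X]) : k[X][X] →ₗ[k] k[X][X] :=
  Polynomial.lsum fun i =>
    ((monomial i : k[X] →ₗ[k[X]] k[X][X]).restrictScalars k) ∘ₗ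
      (LinearMap.mulLeft k h ∘ₗ derivative)

theorem coeff_coeffDeriv (h : k[X]) (f : k[X][X]) (j : ℕ) :
    (coeffDeriv h f).coeff j = h * derivative (f.coeff j) := by
  induction f using Polynomial.induction_on' with
  | add p q hp hq => simp [hp, hq, mul_add]
  | monomial n a =>
    simp only [coeffDeriv, lsum_apply]
    rw [sum_monomial_index _ _ (by simp)]
    simp only [LinearMap.comp_apply, LinearMap.restrictScalars_apply, LinearMap.mulLeft_apply,
      coeff_monomial]
    split_ifs <;> simp

/-- The action of `t` on normal forms: the operator `Y + h d/dx` on `k[x][Y]`. -/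
def opT (h : k[X]) : Module.End k k[X][X] :=
  LinearMap.mulLeft k (X : k[X][X]) + coeffDeriv h

theorem opT_apply (h : k[X]) (f : k[X][X]) : opT h f = X * f + coeffDeriv h f := rfl

theorem coeff_opT_succ (h : k[X]) (f : k[X][X]) (j : ℕ) :
    (opT h f).coeff (j + 1) = f.coeff j + h * derivative (f.coeff (j + 1)) := by
  simp [opT_apply, coeff_coeffDeriv]

theorem aeval_C_X (p : k[X]) : aeval (C X : k[X][X]) p = C p := by
  induction p using Polynomial.induction_on' with
  | add p q hp hq => simp [hp, hq]
  | monomial n a =>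
    rw [aeval_monomial, ← C_pow, Polynomial.algebraMap_apply, ← C_mul, ← C_mul_X_pow_eq_monomial]
    simp

/-- The action of `A_h` on `k[x][Y]` corresponding to left multiplication on normal forms
`∑ pᵢ(x) tⁱ`. -/
def act (h : k[X]) : A h →ₐ[k] Module.End k k[X][X] :=
  A.lift h (Algebra.lmul k k[X][X] (C X)) (opT h) (by
    rw [aeval_algHom_apply, aeval_C_X]
    refine LinearMap.ext fun f => Polynomial.ext fun j => ?_
    cases j <;>
    simp [opT_apply, coeff_coeffDeriv, mul_add] <;> ring)

theorem act_aeval_x (h p : k[X]) (f : k[X][X]) : act h (aeval (A.x h) p) f = C p * f := by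
  rw [← aeval_algHom_apply]
  simp only [act, A.lift_x]
  rw [aeval_algHom_apply, aeval_C_X]
  rfl

theorem act_t (h : k[X]) : act h (A.t h) = opT h := by simp [act]

/-- The coefficients of the normal form: `∑ pᵢ(x) tⁱ ∈ A_h` goes to `∑ pᵢ Yⁱ ∈ k[x][Y]`. -/
def toPoly (h : k[X]) : A h →ₗ[k] k[X][X] := LinearMap.applyₗ 1 ∘ₗ (act h).toLinearMap

theorem toPoly_apply (h : k[X]) (u : A h) : toPoly h u = act h u 1 := rfl

theorem toPoly_mul (h : k[X]) (u v : A h) : toPoly h (u * v) = act h u (toPoly h v) := by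
  simp [toPoly_apply]

theorem toPoly_one (h : k[X]) : toPoly h 1 = 1 := by simp [toPoly_apply]

theorem toPoly_aeval_mul (h p : k[X]) (u : A h) :
    toPoly h (aeval (A.x h) p * u) = C p * toPoly h u := by
  rw [toPoly_mul, act_aeval_x]

theorem toPoly_aeval (h p : k[X]) : toPoly h (aeval (A.x h) p) = C p := by
  simpa [toPoly_one] using toPoly_aeval_mul h p 1

theorem toPoly_x (h : k[X]) : toPoly h (A.x h) = C X := by
  simpa using toPoly_aeval h X

theorem aeval_x_injective (h : k[X]) : Function.Injective (fun p : k[X] => aeval (A.x h) p) := by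
  intro p q hpq
  have := congrArg (toPoly h) hpq
  simpa only [toPoly_aeval, C_inj] using this

theorem toPoly_t_mul (h : k[X]) (u : A h) :
    toPoly h (A.t h * u) = opT h (toPoly h u) := by
  rw [toPoly_mul, act_t]

theorem mem_of_generators {h : k[X]} (S : Subalgebra k (A h)) (hx : A.x h ∈ S) (ht : A.t h ∈ S)
    (u : A h) : u ∈ S := by
  have e : S.val.comp (A.lift h (⟨A.x h, hx⟩ : S) ⟨A.t h, ht⟩ (by
      apply Subtype.ext
      have : ((aeval (⟨A.x h, hx⟩ : S) h : S) : A h) = aeval (A.x h) h :=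
        (aeval_algHom_apply S.val (⟨A.x h, hx⟩ : S) h).symm
      simp [this, A.t_mul_x])) = AlgHom.id k (A h) := by
    apply A.hom_ext <;> simp
  have := DFunLike.congr_fun e u
  simp only [AlgHom.comp_apply, AlgHom.id_apply] at this
  rw [← this]
  exact Subtype.property _

theorem t_mul_aeval (h p : k[X]) :
    A.t h * aeval (A.x h) p = aeval (A.x h) p * A.t h + aeval (A.x h) (h * derivative p) := by
  induction p using Polynomial.induction_on with
  | C a => simp [Algebra.commutes]
  | add p q hp hq => simp only [map_add, mul_add, add_mul, hp, hq]; abel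
  | monomial n a ih =>
    rw [pow_succ, ← mul_assoc]
    generalize C a * X ^ n = q at ih ⊢
    have e : h * derivative (q * X) = q * h + h * derivative q * X := by
      rw [derivative_mul, derivative_X]; ring
    rw [e, map_add, map_mul _ q X, map_mul _ q h, map_mul _ _ X, aeval_X, ← mul_assoc, ih, add_mul,
      mul_assoc _ (A.t h), A.t_mul_x, mul_add, ← mul_assoc, add_assoc]

/-- The element `∑ pᵢ(x) tⁱ` of `A_h` with coefficients `∑ pᵢ Yⁱ`. -/
def ofPoly (h : k[X]) : k[X][X] →ₗ[k] A h :=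
  Polynomial.lsum fun i => LinearMap.mulRight k (A.t h ^ i) ∘ₗ (aeval (A.x h)).toLinearMap

theorem ofPoly_apply (h : k[X]) (f : k[X][X]) :
    ofPoly h f = f.sum fun i p => aeval (A.x h) p * A.t h ^ i := rfl

theorem ofPoly_monomial (h : k[X]) (i : ℕ) (p : k[X]) :
    ofPoly h (monomial i p) = aeval (A.x h) p * A.t h ^ i := by
  rw [ofPoly_apply, sum_monomial_index _ _ (by simp)]

theorem coeffDeriv_monomial (h p : k[X]) (i : ℕ) :
    coeffDeriv h (monomial i p) = monomial i (h * derivative p) := by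
  ext1 j
  rw [coeff_coeffDeriv, coeff_monomial, coeff_monomial]
  split_ifs <;> simp

theorem ofPoly_act (h : k[X]) (u : A h) (f : k[X][X]) : ofPoly h (act h u f) = u * ofPoly h f := by
  let S : Subalgebra k (A h) :=
    { carrier := {u | ∀ f, ofPoly h (act h u f) = u * ofPoly h f}
      mul_mem' := by
        intro a b ha hb f
        rw [map_mul, Module.End.mul_apply, ha, hb, mul_assoc]
      add_mem' := by
        intro a b ha hb f
        rw [map_add, LinearMap.add_apply, map_add, ha, hb, add_mul]
      algebraMap_mem' := by
        intro c f
        rw [AlgHom.commutes, Module.algebraMap_end_apply, map_smul, Algebra.smul_def] }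
  refine mem_of_generators S (fun f => ?_) (fun f => ?_) u f
  · have e := act_aeval_x h X f
    rw [aeval_X] at e
    rw [e]
    clear e
    induction f using Polynomial.induction_on' with
    | add p q hp hq => rw [mul_add, map_add, map_add, mul_add, hp, hq]
    | monomial i p =>
      rw [C_mul_monomial, ofPoly_monomial, ofPoly_monomial, map_mul, aeval_X, mul_assoc]
  · rw [act_t]
    induction f using Polynomial.induction_on' with
    | add p q hp hq => rw [map_add, map_add, map_add, mul_add, hp, hq]
    | monomial i p =>
      rw [opT_apply, coeffDeriv_monomial, X_mul_monomial, map_add, ofPoly_monomial,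
        ofPoly_monomial, ofPoly_monomial, ← mul_assoc, t_mul_aeval, add_mul, mul_assoc, pow_succ']

theorem ofPoly_toPoly (h : k[X]) (u : A h) : ofPoly h (toPoly h u) = u := by
  rw [toPoly_apply, ofPoly_act, ← monomial_zero_one, ofPoly_monomial]
  simp

theorem toPoly_injective (h : k[X]) : Function.Injective (toPoly h) :=
  Function.LeftInverse.injective (ofPoly_toPoly h)

/-- The normal form: every element of `A_h` is `∑ pᵢ(x) tⁱ`. -/
theorem eq_sum_range {h : k[X]} {u : A h} {d : ℕ} (hu : (toPoly h u).natDegree ≤ d) :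
    u = ∑ i ∈ Finset.range (d + 1), aeval (A.x h) ((toPoly h u).coeff i) * A.t h ^ i := by
  conv_lhs => rw [← ofPoly_toPoly h u, ofPoly_apply]
  exact sum_over_range' _ (by simp) _ (Nat.lt_succ_of_le hu)

theorem eq_aeval_of_natDegree_eq_zero {h : k[X]} {u : A h} (hu : (toPoly h u).natDegree = 0) :
    u = aeval (A.x h) ((toPoly h u).coeff 0) := by
  simpa using eq_sum_range hu.le

/-! ### Leading terms -/

/-- The pattern behind all leading-term computations in `A_h`: when the `i`-th summand has degree
at most `i + m`, only the last one reaches degree `d + m`. -/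
theorem natDegree_coeff_sum {R : Type*} [Semiring R] {d m : ℕ} {F : ℕ → R[X]}
    (hF : ∀ i, (F i).natDegree ≤ i + m) :
    (∑ i ∈ Finset.range (d + 1), F i).natDegree ≤ d + m ∧
      (∑ i ∈ Finset.range (d + 1), F i).coeff (d + m) = (F d).coeff (d + m) := by
  constructor
  · refine natDegree_sum_le_of_forall_le _ _ fun i hi => (hF i).trans ?_
    have := Finset.mem_range.1 hi
    omega
  · rw [finsetSum_coeff]
    refine Finset.sum_eq_single d (fun i hi hid => ?_) (fun hd => by simp at hd)
    have := Finset.mem_range.1 hi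
    exact coeff_eq_zero_of_natDegree_lt ((hF i).trans_lt (by omega))

theorem natDegree_coeff_opT {h : k[X]} {f : k[X][X]} {m : ℕ} (hf : f.natDegree ≤ m) :
    (opT h f).natDegree ≤ m + 1 ∧ (opT h f).coeff (m + 1) = f.coeff m := by
  have key : ∀ j, m ≤ j → (opT h f).coeff (j + 1) = f.coeff j := fun j hj => by
    rw [coeff_opT_succ, coeff_eq_zero_of_natDegree_lt (by omega : f.natDegree < j + 1)]
    simp
  refine ⟨natDegree_le_iff_coeff_eq_zero.2 fun j hj => ?_, key m le_rfl⟩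
  obtain ⟨j, rfl⟩ : ∃ i, j = i + 1 := ⟨j - 1, by omega⟩
  rw [key j (by omega), coeff_eq_zero_of_natDegree_lt (by omega)]

theorem natDegree_coeff_t_pow_mul {h : k[X]} {u : A h} {m : ℕ} (hu : (toPoly h u).natDegree ≤ m)
    (i : ℕ) : (toPoly h (A.t h ^ i * u)).natDegree ≤ i + m ∧
      (toPoly h (A.t h ^ i * u)).coeff (i + m) = (toPoly h u).coeff m := by
  induction i with
  | zero => simpa using hu
  | succ i ih =>
    rw [pow_succ', mul_assoc, toPoly_t_mul, add_right_comm]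
    exact ⟨(natDegree_coeff_opT ih.1).1, (natDegree_coeff_opT ih.1).2.trans ih.2⟩

/-- The `t`-degree is subadditive and top coefficients multiply. -/
theorem natDegree_coeff_mul {h : k[X]} {u v : A h} {d m : ℕ} (hu : (toPoly h u).natDegree ≤ d)
    (hv : (toPoly h v).natDegree ≤ m) :
    (toPoly h (u * v)).natDegree ≤ d + m ∧
      (toPoly h (u * v)).coeff (d + m) = (toPoly h u).coeff d * (toPoly h v).coeff m := by
  have e : toPoly h (u * v) = ∑ i ∈ Finset.range (d + 1),
      C ((toPoly h u).coeff i) * toPoly h (A.t h ^ i * v) := by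
    conv_lhs => rw [eq_sum_range hu]
    rw [Finset.sum_mul, map_sum]
    exact Finset.sum_congr rfl fun i _ => by rw [mul_assoc, toPoly_aeval_mul]
  have key := natDegree_coeff_sum (d := d) (m := m)
    (F := fun i => C ((toPoly h u).coeff i) * toPoly h (A.t h ^ i * v))
    fun i => (natDegree_C_mul_le _ _).trans (natDegree_coeff_t_pow_mul hv i).1
  rw [e]
  refine ⟨key.1, key.2.trans ?_⟩
  rw [coeff_C_mul, (natDegree_coeff_t_pow_mul hv d).2]

theorem natDegree_coeff_pow {h : k[X]} {u : A h} {d : ℕ} (hu : (toPoly h u).natDegree ≤ d)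
    (n : ℕ) : (toPoly h (u ^ n)).natDegree ≤ n * d ∧
      (toPoly h (u ^ n)).coeff (n * d) = (toPoly h u).coeff d ^ n := by
  induction n with
  | zero => simp [toPoly_one]
  | succ n ih =>
    rw [pow_succ, pow_succ, add_mul, one_mul, ← ih.2]
    exact natDegree_coeff_mul ih.1 hu

instance (h : k[X]) : NoZeroDivisors (A h) where
  eq_zero_or_eq_zero_of_mul_eq_zero {u v} huv := by
    have key := (natDegree_coeff_mul (le_refl (toPoly h u).natDegree)
      (le_refl (toPoly h v).natDegree)).2
    rw [huv, map_zero, coeff_zero, eq_comm, mul_eq_zero] at key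
    simpa [← (toPoly_injective h).eq_iff] using key

theorem exists_algebraMap_of_mul_eq_one {h : k[X]} {u v : A h} (huv : u * v = 1) :
    ∃ c : k, c ≠ 0 ∧ u = algebraMap k (A h) c := by
  have key := natDegree_coeff_mul (le_refl (toPoly h u).natDegree) (le_refl (toPoly h v).natDegree)
  rw [huv, toPoly_one] at key
  have hu : toPoly h u ≠ 0 := fun h0 => by
    have : u = 0 := toPoly_injective h (by simpa using h0)
    rw [this, zero_mul] at huv
    simpa [toPoly_one] using congrArg (toPoly h) huv
  have hv : toPoly h v ≠ 0 := fun h0 => by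
    have : v = 0 := toPoly_injective h (by simpa using h0)
    rw [this, mul_zero] at huv
    simpa [toPoly_one] using congrArg (toPoly h) huv
  have hne : (toPoly h u).leadingCoeff * (toPoly h v).leadingCoeff ≠ 0 :=
    mul_ne_zero (leadingCoeff_ne_zero.2 hu) (leadingCoeff_ne_zero.2 hv)
  have hd : (toPoly h u).natDegree + (toPoly h v).natDegree = 0 := by
    by_contra hd
    exact hne (key.2.symm.trans (by rw [coeff_one, if_neg hd]))
  have hdu : (toPoly h u).natDegree = 0 := by omega
  have hdv : (toPoly h v).natDegree = 0 := by omega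
  have h1 := key.2
  rw [hdu, hdv, coeff_one_zero] at h1
  obtain ⟨c, hc, hcu⟩ := isUnit_iff.1 (IsUnit.of_mul_eq_one _ h1.symm)
  exact ⟨c, hc.ne_zero, by rw [eq_aeval_of_natDegree_eq_zero hdu, ← hcu, aeval_C]⟩

/-! ### The centralizer of `x` -/

theorem toPoly_t_pow_mul_x (h : k[X]) (n : ℕ) :
    (toPoly h (A.t h ^ (n + 1) * A.x h)).coeff n = (n + 1 : ℕ) * h := by
  have hd : (toPoly h (A.x h)).natDegree ≤ 0 := by simp [toPoly_x]
  induction n with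
  | zero => simp [toPoly_t_mul, toPoly_x, opT_apply, coeff_coeffDeriv]
  | succ n ih =>
    have top := (natDegree_coeff_t_pow_mul hd (n + 1)).2
    rw [add_zero, toPoly_x, coeff_C_zero] at top
    rw [pow_succ', mul_assoc, toPoly_t_mul, coeff_opT_succ, ih, top]
    push_cast
    simp
    ring

/-- The centralizer of `x` is `k[x]`: the commutator of `x` with an element of `t`-degree
`d + 1` has coefficient `± (d + 1) h` times the leading one in degree `d`. -/
theorem exists_eq_aeval_of_commute [CharZero k] {h : k[X]} (hh : h ≠ 0) {u : A h}
    (hu : u * A.x h = A.x h * u) : ∃ p : k[X], u = aeval (A.x h) p := by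
  rcases Nat.eq_zero_or_eq_succ_pred (toPoly h u).natDegree with hd | hd
  · exact ⟨_, eq_aeval_of_natDegree_eq_zero hd⟩
  exfalso
  set d := (toPoly h u).natDegree.pred
  have hxd : (toPoly h (A.x h)).natDegree ≤ 0 := by simp [toPoly_x]
  have e : toPoly h (u * A.x h) = ∑ i ∈ Finset.range (d + 1 + 1),
      C ((toPoly h u).coeff i) * toPoly h (A.t h ^ i * A.x h) := by
    conv_lhs => rw [eq_sum_range hd.le]
    rw [Finset.sum_mul, map_sum]
    exact Finset.sum_congr rfl fun i _ => by rw [mul_assoc, toPoly_aeval_mul]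
  have low := (natDegree_coeff_sum (d := d) (m := 0)
    (F := fun i => C ((toPoly h u).coeff i) * toPoly h (A.t h ^ i * A.x h))
    fun i => (natDegree_C_mul_le _ _).trans (natDegree_coeff_t_pow_mul hxd i).1).2
  have topd := (natDegree_coeff_t_pow_mul hxd d).2
  rw [add_zero] at low topd
  have e2 := congrArg (fun f => f.coeff d) e
  rw [Finset.sum_range_succ, coeff_add, low, coeff_C_mul, coeff_C_mul, topd, toPoly_x, coeff_C_zero,
    toPoly_t_pow_mul_x, hu] at e2
  have e3 := toPoly_aeval_mul h X u
  rw [aeval_X] at e3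
  rw [e3, coeff_C_mul, mul_comm X, left_eq_add] at e2
  have hlc : (toPoly h u).coeff (d + 1) ≠ 0 := by
    rw [← Nat.succ_eq_add_one, ← hd]
    refine leadingCoeff_ne_zero.2 fun h0 => ?_
    rw [h0] at hd
    simp at hd
  exact mul_ne_zero hlc (mul_ne_zero (Nat.cast_ne_zero.2 (Nat.succ_ne_zero d)) hh) e2

/-! ### The ideal generated by commutators -/

/-- `h` is a normal element: `A h ⊆ h A`. -/
theorem exists_mul_aeval_eq (h : k[X]) (u : A h) :
    ∃ v, u * aeval (A.x h) h = aeval (A.x h) h * v := by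
  let S : Subalgebra k (A h) :=
    { carrier := {u | ∃ v, u * aeval (A.x h) h = aeval (A.x h) h * v}
      mul_mem' := by
        rintro a b ⟨a', ha⟩ ⟨b', hb⟩
        exact ⟨a' * b', by rw [mul_assoc, hb, ← mul_assoc, ha, mul_assoc]⟩
      add_mem' := by
        rintro a b ⟨a', ha⟩ ⟨b', hb⟩
        exact ⟨a' + b', by rw [add_mul, mul_add, ha, hb]⟩
      algebraMap_mem' := fun c => ⟨algebraMap k _ c, Algebra.commutes _ _⟩ }
  refine mem_of_generators S ⟨A.x h, (aeval_mul_x h h).symm⟩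
    ⟨A.t h + aeval (A.x h) (derivative h), ?_⟩ u
  rw [t_mul_aeval, map_mul, mul_add]

theorem commutator_mem_of_generators {h : k[X]} {v : A h}
    (hx : ∃ z, A.x h * v - v * A.x h = aeval (A.x h) h * z)
    (ht : ∃ z, A.t h * v - v * A.t h = aeval (A.x h) h * z) (u : A h) :
    ∃ z, u * v - v * u = aeval (A.x h) h * z := by
  let S : Subalgebra k (A h) :=
    { carrier := {u | ∃ z, u * v - v * u = aeval (A.x h) h * z}
      mul_mem' := by
        rintro a b ⟨a', ha⟩ ⟨b', hb⟩
        obtain ⟨a'', ha''⟩ := exists_mul_aeval_eq h a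
        refine ⟨a'' * b' + a' * b, ?_⟩
        calc a * b * v - v * (a * b) = a * (b * v - v * b) + (a * v - v * a) * b := by
              noncomm_ring
          _ = _ := by rw [ha, hb, ← mul_assoc, ha'', mul_add, mul_assoc, mul_assoc]
      add_mem' := by
        rintro a b ⟨a', ha⟩ ⟨b', hb⟩
        exact ⟨a' + b', by rw [add_mul, mul_add, mul_add, ← ha, ← hb]; abel⟩
      algebraMap_mem' := fun c => ⟨0, by rw [Algebra.commutes, sub_self, mul_zero]⟩ }
  exact mem_of_generators S hx ht u

/-- All commutators lie in `h A_h`. -/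
theorem exists_commutator_eq (h : k[X]) (u v : A h) :
    ∃ z, u * v - v * u = aeval (A.x h) h * z := by
  have neg : ∀ {a b : A h}, (∃ z, a * b - b * a = aeval (A.x h) h * z) →
      ∃ z, b * a - a * b = aeval (A.x h) h * z := by
    rintro a b ⟨z, hz⟩
    exact ⟨-z, by rw [mul_neg, ← hz, neg_sub]⟩
  have tx : ∃ z, A.t h * A.x h - A.x h * A.t h = aeval (A.x h) h * z :=
    ⟨1, by rw [A.t_mul_x, mul_one, add_sub_cancel_left]⟩
  have self : ∀ a : A h, ∃ z, a * a - a * a = aeval (A.x h) h * z := fun a => ⟨0, by simp⟩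
  exact commutator_mem_of_generators
    (neg (commutator_mem_of_generators (self _) tx v))
    (neg (commutator_mem_of_generators (neg tx) (self _) v)) u

/-- The element `h` generates the ideal spanned by commutators, so every automorphism fixes it
up to a unit. -/
theorem exists_map_aeval_eq (h : k[X]) (hh : h ≠ 0) (ρ : A h ≃ₐ[k] A h) :
    ∃ c : k, c ≠ 0 ∧ ρ (aeval (A.x h) h) = aeval (A.x h) (C c * h) := by
  have comm : ∀ ρ : A h ≃ₐ[k] A h, ∃ z, ρ (aeval (A.x h) h) = aeval (A.x h) h * z := fun ρ => by
    obtain ⟨z, hz⟩ := exists_commutator_eq h (ρ (A.t h)) (ρ (A.x h))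
    refine ⟨z, hz ▸ ?_⟩
    rw [← map_mul, ← map_mul, ← map_sub, A.t_mul_x, add_sub_cancel_left]
  obtain ⟨u, hu⟩ := comm ρ
  obtain ⟨v, hv⟩ := comm ρ.symm
  have hne : aeval (A.x h) h ≠ 0 := fun h0 => hh (aeval_x_injective h (by simpa using h0))
  have huv : u * ρ v = 1 := by
    refine mul_left_cancel₀ hne ?_
    rw [← mul_assoc, ← hu, ← map_mul, ← hv, AlgEquiv.apply_symm_apply, mul_one]
  obtain ⟨c, hc, rfl⟩ := exists_algebraMap_of_mul_eq_one huv
  exact ⟨c, hc, by rw [hu, map_mul, aeval_C, Algebra.commutes]⟩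

/-! ### The automorphism group -/

theorem coeff_linear_pow (a b : k) (n : ℕ) :
    ((C a * X + C b) ^ n).coeff n = a ^ n ∧
      ((C a * X + C b) ^ (n + 1)).coeff n = (n + 1 : ℕ) * a ^ n * b := by
  have rec1 : ∀ (q : k[X]) (m : ℕ), (q * (C a * X + C b)).coeff (m + 1)
      = q.coeff m * a + q.coeff (m + 1) * b := fun q m => by
    rw [mul_add, coeff_add, coeff_mul_C, ← mul_assoc, coeff_mul_X, coeff_mul_C]
  induction n with
  | zero => simp
  | succ n ih =>
    have hdeg : ((C a * X + C b) ^ n).natDegree ≤ n :=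
      (natDegree_pow_le_of_le n natDegree_linear_le).trans (by simp)
    have top : ((C a * X + C b) ^ (n + 1)).coeff (n + 1) = a ^ (n + 1) := by
      rw [pow_succ, rec1, ih.1, coeff_eq_zero_of_natDegree_lt (by omega)]
      ring
    refine ⟨top, ?_⟩
    rw [pow_succ, rec1, ih.2, top]
    push_cast
    ring

/-- A substitution that multiplies a depressed polynomial by a scalar is a scaling of the
variable: degrees force it to be affine, the coefficient of degree `N - 1` kills its constant
term. -/
theorem eq_C_mul_X_of_comp_eq [CharZero k] {h p : k[X]} {c : k} (hdeg : 2 ≤ h.natDegree)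
    (hmonic : h.Monic) (hcoeff : h.coeff (h.natDegree - 1) = 0) (hc : c ≠ 0)
    (hp : h.comp p = C c * h) : ∃ a : k, a ≠ 0 ∧ p = C a * X ∧ c = a ^ h.natDegree := by
  have hd : p.natDegree = 1 := by
    have := congrArg natDegree hp
    rw [natDegree_comp, natDegree_C_mul hc] at this
    exact Nat.eq_of_mul_eq_mul_left (by omega) (this.trans (mul_one _).symm)
  obtain ⟨a, b, rfl⟩ := exists_eq_X_add_C_of_natDegree_le_one hd.le
  have ha : a ≠ 0 := by
    rintro rfl
    simp at hd
  obtain ⟨M, hM⟩ : ∃ M, h.natDegree = M + 1 := ⟨h.natDegree - 1, by omega⟩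
  have hlow : ∀ i j, i < j → ((C a * X + C b) ^ i).coeff j = 0 := fun i j hij =>
    coeff_eq_zero_of_natDegree_lt
      ((natDegree_pow_le_of_le i natDegree_linear_le).trans_lt (by omega))
  have expand : ∀ j, (h.comp (C a * X + C b)).coeff j =
      ∑ i ∈ Finset.range (M + 1 + 1), h.coeff i * ((C a * X + C b) ^ i).coeff j := fun j => by
    rw [comp, eval₂_eq_sum_range, hM, finsetSum_coeff]
    exact Finset.sum_congr rfl fun i _ => coeff_C_mul _
  have hlead : h.coeff (M + 1) = 1 := hM ▸ hmonic.coeff_natDegree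
  rw [hM, Nat.add_sub_cancel] at hcoeff
  have top := expand (M + 1)
  rw [Finset.sum_range_succ, Finset.sum_eq_zero, hp, coeff_C_mul, hlead,
    (coeff_linear_pow a b (M + 1)).1] at top
  swap
  · exact fun i hi => by rw [hlow _ _ (Finset.mem_range.1 hi), mul_zero]
  have sub := expand M
  rw [Finset.sum_range_succ, Finset.sum_range_succ, Finset.sum_eq_zero, hp, coeff_C_mul, hlead,
    hcoeff, (coeff_linear_pow a b M).2] at sub
  swap
  · exact fun i hi => by rw [hlow _ _ (Finset.mem_range.1 hi), mul_zero]
  have hb : b = 0 := by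
    have : ((M + 1 : ℕ) : k) * a ^ M * b = 0 := by simpa using sub.symm
    exact (mul_eq_zero.1 this).resolve_left
      (mul_ne_zero (Nat.cast_ne_zero.2 (Nat.succ_ne_zero M)) (pow_ne_zero _ ha))
  refine ⟨a, ha, by simp [hb], ?_⟩
  rw [hM]
  simpa using top

theorem coeff_toPoly_aeval {h p : k[X]} {u : A h} {d : ℕ} (hd : 0 < d)
    (hu : (toPoly h u).natDegree ≤ d) :
    (toPoly h (aeval u p)).coeff (p.natDegree * d) =
      C p.leadingCoeff * (toPoly h u).coeff d ^ p.natDegree := by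
  rw [aeval_eq_sum_range, map_sum, finsetSum_coeff, Finset.sum_range_succ, Finset.sum_eq_zero,
    map_smul, coeff_smul, (natDegree_coeff_pow hu _).2, zero_add, smul_eq_C_mul, leadingCoeff]
  intro i hi
  have hlow := coeff_eq_zero_of_natDegree_lt ((natDegree_coeff_pow hu i).1.trans_lt
    (Nat.mul_lt_mul_of_pos_right (Finset.mem_range.1 hi) hd))
  rw [map_smul, coeff_smul, hlow, smul_zero]

/-- An automorphism sends `x` to a multiple of `x`: the relation `h(ρ(x)) = c h(x)` bounds the
`t`-degree of `ρ(x)` by zero. -/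
theorem exists_map_x_eq [CharZero k] {h : k[X]} (hdeg : 2 ≤ h.natDegree) (hmonic : h.Monic)
    (hcoeff : h.coeff (h.natDegree - 1) = 0) (ρ : A h ≃ₐ[k] A h) :
    ∃ a : scaling h, ρ (A.x h) = (a : kˣ) • A.x h ∧
      ρ (aeval (A.x h) h) = aeval (A.x h) (C (((a : kˣ) : k) ^ h.natDegree) * h) := by
  obtain ⟨c, hc, hρ⟩ := exists_map_aeval_eq h hmonic.ne_zero ρ
  have hρ' : aeval (ρ (A.x h)) h = aeval (A.x h) (C c * h) :=
    (aeval_algHom_apply (ρ : A h →ₐ[k] A h) (A.x h) h).trans hρ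
  have hd : (toPoly h (ρ (A.x h))).natDegree = 0 := by
    by_contra hd
    have key := coeff_toPoly_aeval (p := h) (Nat.pos_of_ne_zero hd) le_rfl
    rw [hρ', toPoly_aeval, coeff_C_of_ne_zero (mul_ne_zero (by omega) hd), hmonic.leadingCoeff,
      C_1, one_mul, eq_comm, pow_eq_zero_iff (by omega)] at key
    exact hd (by rw [leadingCoeff_eq_zero.1 key, natDegree_zero])
  have hx := eq_aeval_of_natDegree_eq_zero hd
  set p := (toPoly h (ρ (A.x h))).coeff 0
  rw [hx, ← aeval_comp] at hρ'
  have hcomp : h.comp p = C c * h := aeval_x_injective h hρ'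
  obtain ⟨a, ha, hpa, rfl⟩ := eq_C_mul_X_of_comp_eq hdeg hmonic hcoeff hc hcomp
  rw [hpa] at hcomp hx
  refine ⟨⟨Units.mk0 a ha, hcomp⟩, ?_, hρ⟩
  rw [hx, map_mul, aeval_C, aeval_X, ← Algebra.smul_def]
  rfl

theorem tau_t_eq_pow {h : k[X]} (hdeg : 1 ≤ h.natDegree) (a : scaling h) :
    tau h a (A.t h) = ((a : kˣ) : k) ^ (h.natDegree - 1) • A.t h := by
  rw [tau_t, ← Nat.cast_pred hdeg, zpow_natCast, Units.smul_def, Units.val_pow_eq_pow_val]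

/-- `Aut(A_h) = k[x] ⋊ {a | h(ax) = a^N h(x)}`. -/
theorem exists_eq_sigma_mul_tau [CharZero k] {h : k[X]} (hdeg : 2 ≤ h.natDegree)
    (hmonic : h.Monic) (hcoeff : h.coeff (h.natDegree - 1) = 0) (ρ : A h ≃ₐ[k] A h) :
    ∃ (r : k[X]) (a : scaling h), ρ = sigma h (.ofAdd r) * tau h a := by
  obtain ⟨a, hx, hh⟩ := exists_map_x_eq hdeg hmonic hcoeff ρ
  have ha : ((a : kˣ) : k) ≠ 0 := Units.ne_zero _
  set b : k := ((a : kˣ) : k) ^ (h.natDegree - 1) with hb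
  have hb0 : b ≠ 0 := pow_ne_zero _ ha
  have hab : ((a : kˣ) : k) ^ h.natDegree = ((a : kˣ) : k) * b := by
    rw [hb, ← pow_succ']
    congr 1
    omega
  rw [Units.smul_def] at hx
  -- `ρ(t)` and `a^(N-1) t` have the same commutator with `x`.
  have hcomm : (ρ (A.t h) - b • A.t h) * A.x h = A.x h * (ρ (A.t h) - b • A.t h) := by
    have e := congrArg ρ (A.t_mul_x h)
    rw [map_mul, map_add, map_mul, hx, hh, hab, map_mul, aeval_C, ← Algebra.smul_def, mul_smul_comm,
      smul_mul_assoc, mul_smul, ← smul_add] at e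
    have e' := smul_right_injective (A h) ha e
    rw [sub_mul, mul_sub, e', smul_mul_assoc, mul_smul_comm, A.t_mul_x, smul_add]
    abel
  obtain ⟨q, hq⟩ := exists_eq_aeval_of_commute hmonic.ne_zero hcomm
  refine ⟨C b⁻¹ * q, a, A.equiv_ext ?_ ?_⟩
  · rw [AlgEquiv.mul_apply, tau_x, Units.smul_def, map_smul, sigma_x, hx]
  · rw [AlgEquiv.mul_apply, tau_t_eq_pow (by omega), map_smul, sigma_t, smul_add, map_mul, aeval_C,
      ← Algebra.smul_def, smul_smul, ← hb, mul_inv_cancel₀ hb0, one_smul, ← hq]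
    abel

theorem sigma_mul_tau_x (h r : k[X]) (a : scaling h) :
    (sigma h (.ofAdd r) * tau h a) (A.x h) = ((a : kˣ) : k) • A.x h := by
  rw [AlgEquiv.mul_apply, tau_x, Units.smul_def, map_smul, sigma_x]

theorem sigma_mul_tau_t {h : k[X]} (hdeg : 1 ≤ h.natDegree) (r : k[X]) (a : scaling h) :
    (sigma h (.ofAdd r) * tau h a) (A.t h) =
      ((a : kˣ) : k) ^ (h.natDegree - 1) • (A.t h + aeval (A.x h) r) := by
  rw [AlgEquiv.mul_apply, tau_t_eq_pow hdeg, map_smul, sigma_t]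

theorem map_aeval_x {h : k[X]} {ρ : A h ≃ₐ[k] A h} {a : k} (hx : ρ (A.x h) = a • A.x h)
    (p : k[X]) : ρ (aeval (A.x h) p) = aeval (A.x h) (p.comp (C a * X)) := by
  have : ρ (aeval (A.x h) p) = aeval (ρ (A.x h)) p :=
    (aeval_algHom_apply (ρ : A h →ₐ[k] A h) (A.x h) p).symm
  rw [this, hx, aeval_comp, map_mul, aeval_C, aeval_X, Algebra.smul_def]

/-- The effect of a triangular automorphism on the coefficient of top `t`-degree. -/
theorem coeff_toPoly_map {h : k[X]} {ρ : A h ≃ₐ[k] A h} {a b : k} {r : k[X]}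
    (hx : ρ (A.x h) = a • A.x h) (ht : ρ (A.t h) = b • (A.t h + aeval (A.x h) r))
    {u : A h} {d : ℕ} (hu : (toPoly h u).natDegree ≤ d) :
    (toPoly h (ρ u)).coeff d = C (b ^ d) * ((toPoly h u).coeff d).comp (C a * X) := by
  have htd : toPoly h (ρ (A.t h)) = C (C b) * (X + C r) := by
    have e : toPoly h (A.t h) = X := by
      have := toPoly_t_mul h 1
      rw [mul_one, toPoly_one, opT_apply] at this
      rw [this, ← C_1, ← monomial_zero_left (R := k[X]), coeffDeriv_monomial]
      simp
    rw [ht, map_smul, map_add, e, toPoly_aeval, Algebra.smul_def]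
    rfl
  have htn : (toPoly h (ρ (A.t h))).natDegree ≤ 1 := by
    rw [htd]
    exact (natDegree_C_mul_le _ _).trans (natDegree_X_add_C r).le
  have htc : (toPoly h (ρ (A.t h))).coeff 1 = C b := by rw [htd]; simp
  have e : toPoly h (ρ u) = ∑ i ∈ Finset.range (d + 1),
      C (((toPoly h u).coeff i).comp (C a * X)) * toPoly h (ρ (A.t h) ^ i) := by
    conv_lhs => rw [eq_sum_range hu]
    rw [map_sum, map_sum]
    exact Finset.sum_congr rfl fun i _ => by
      rw [map_mul, map_pow, map_aeval_x hx, toPoly_aeval_mul]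
  have key := (natDegree_coeff_sum (d := d) (m := 0)
    (F := fun i => C (((toPoly h u).coeff i).comp (C a * X)) * toPoly h (ρ (A.t h) ^ i))
    fun i => (natDegree_C_mul_le _ _).trans ((natDegree_coeff_pow htn i).1.trans (by simp))).2
  have pw := (natDegree_coeff_pow htn d).2
  rw [mul_one, htc] at pw
  rw [add_zero] at key
  rw [e, key, coeff_C_mul, pw, mul_comm, C_pow]

/-! ### Isotropy groups -/

theorem delta_aeval (h s p : k[X]) : (delta h s).1 (aeval (A.x h) p) = 0 := by
  have e : deltaHom h s (aeval (A.x h) p) = TrivSqZeroExt.inl (aeval (A.x h) p) := by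
    rw [← aeval_algHom_apply, deltaHom, A.lift_x]
    exact aeval_algHom_apply (TrivSqZeroExt.inlAlgHom k (A h) (A h)) (A.x h) p
  exact (congrArg TrivSqZeroExt.snd e).trans (TrivSqZeroExt.snd_inl _ _)

/-- An automorphism commuting with `ad_w + Δ_s` fixes `w` up to a constant. The difference
`ρ(w) - w` commutes with `x`, so it is some `f(x)`; then `h f'` is a combination of `s(x)` and
`s(ax)`, which have smaller degree than `h`, so `f' = 0`. -/
theorem exists_map_eq_add_of_mem_isotropy [CharZero k] {h : k[X]} (hdeg : 1 ≤ h.natDegree)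
    {w : A h} {s : k[X]} (hs : s.degree < h.degree) {r : k[X]} {a : scaling h}
    (hρ : sigma h (.ofAdd r) * tau h a ∈ isotropy (ad w + delta h s)) :
    ∃ c : k, (sigma h (.ofAdd r) * tau h a) w = w + algebraMap k (A h) c := by
  have hx := sigma_mul_tau_x h r a
  have ht := sigma_mul_tau_t hdeg r a
  set ρ := sigma h (.ofAdd r) * tau h a
  have ha : ((a : kˣ) : k) ≠ 0 := Units.ne_zero _
  have hb : ((a : kˣ) : k) ^ (h.natDegree - 1) ≠ 0 := pow_ne_zero _ ha
  generalize ((a : kˣ) : k) ^ (h.natDegree - 1) = b at ht hb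
  generalize ((a : kˣ) : k) = a' at hx ha
  have hh : h ≠ 0 := fun h0 => by simp [h0] at hdeg
  have comm : ∀ u, (ρ w - w) * ρ u - ρ u * (ρ w - w) =
      (delta h s).1 (ρ u) - ρ ((delta h s).1 u) := fun u => by
    have e : ρ (w * u - u * w + (delta h s).1 u) = w * ρ u - ρ u * w + (delta h s).1 (ρ u) := hρ u
    rw [map_add, map_sub, map_mul, map_mul] at e
    rw [sub_mul, mul_sub, ← sub_eq_zero]
    rw [← sub_eq_zero] at e
    rw [← e]
    abel
  have hcx := comm (A.x h)
  rw [hx, delta_x, map_smul, delta_x, map_zero, smul_zero, sub_zero, mul_smul_comm, smul_mul_assoc,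
    ← smul_sub, smul_eq_zero_iff_right ha, sub_eq_zero] at hcx
  obtain ⟨f, hf⟩ := exists_eq_aeval_of_commute hh hcx
  have hct := comm (A.t h)
  have key : C b * (h * derivative f) = s.comp (C a' * X) - C b * s := by
    apply aeval_x_injective h
    have hfr : aeval (A.x h) f * aeval (A.x h) r = aeval (A.x h) r * aeval (A.x h) f := by
      rw [← map_mul, mul_comm, map_mul]
    rw [hf, ht, map_smul, map_add, delta_t, delta_aeval, add_zero, map_aeval_x hx, mul_smul_comm,
      smul_mul_assoc, ← smul_sub, mul_add, add_mul, t_mul_aeval, hfr, add_sub_add_right_eq_sub,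
      sub_add_cancel_left, smul_neg, neg_eq_iff_eq_neg, neg_sub] at hct
    simpa [map_mul, aeval_C, ← Algebra.smul_def] using hct
  have hf' : derivative f = 0 := by
    by_contra hne
    have h1 : (C b * (h * derivative f)).degree < h.degree := by
      rw [key]
      refine (degree_sub_le _ _).trans_lt (max_lt ?_ ?_)
      · refine lt_of_le_of_lt (degree_mono fun i hi => ?_) hs
        rw [mem_support_iff, comp_C_mul_X_coeff] at hi
        exact mem_support_iff.2 (left_ne_zero_of_mul hi)
      · rwa [degree_C_mul hb]
    rw [degree_C_mul hb] at h1
    exact absurd h1 (degree_le_mul_left h hne).not_gt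
  obtain ⟨c, rfl⟩ : ∃ c, f = C c := ⟨_, eq_C_of_derivative_eq_zero hf'⟩
  exact ⟨c, by rw [← aeval_C, ← hf]; abel⟩

/-- If a triangular automorphism fixes a nonconstant `w` up to a constant, then the exponent
`deg p + (N - 1) d`, where `p(x) t^d` is the leading term of `w`, kills its scalar. -/
theorem exists_pow_eq_one [CharZero k] {h : k[X]} (hdeg : 2 ≤ h.natDegree) {w : A h}
    (hw : w ∉ Set.range (algebraMap k (A h))) {s : k[X]} (hs : s.degree < h.degree) :
    ∃ n : ℕ, 1 ≤ n ∧ ∀ (r : k[X]) (a : scaling h),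
      sigma h (.ofAdd r) * tau h a ∈ isotropy (ad w + delta h s) → (a : kˣ) ^ n = 1 := by
  have hw0 : w ≠ 0 := by
    rintro rfl
    exact hw ⟨0, map_zero _⟩
  have hp : toPoly h w ≠ 0 := fun h0 => hw0 (toPoly_injective h (by simpa using h0))
  set d := (toPoly h w).natDegree with hd
  set p := (toPoly h w).coeff d with hpd
  have hp0 : p ≠ 0 := leadingCoeff_ne_zero.2 hp
  have hdp : d ≠ 0 ∨ p.natDegree ≠ 0 := by
    by_contra! hcon
    apply hw
    rw [eq_aeval_of_natDegree_eq_zero hcon.1, ← hcon.1, ← hpd,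
      eq_C_of_natDegree_eq_zero hcon.2, aeval_C]
    exact ⟨_, rfl⟩
  refine ⟨p.natDegree + (h.natDegree - 1) * d, ?_, fun r a hρ => ?_⟩
  · rcases hdp with hd0 | hp1
    · have := Nat.mul_pos (by omega : 0 < h.natDegree - 1) (Nat.pos_of_ne_zero hd0)
      omega
    · omega
  obtain ⟨c, hc⟩ := exists_map_eq_add_of_mem_isotropy (by omega) hs hρ
  have e := coeff_toPoly_map (sigma_mul_tau_x h r a) (sigma_mul_tau_t (by omega) r a) hd.ge
  have e2 := congrArg (fun q => q.coeff p.natDegree) e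
  rw [hc, map_add, ← aeval_C (A.x h), toPoly_aeval, coeff_add, coeff_add, ← hpd, coeff_C_mul,
    comp_C_mul_X_coeff] at e2
  -- The constant `c` does not reach the leading term, as `w` is not constant.
  have hz : ((C (C c) : k[X][X]).coeff d).coeff p.natDegree = 0 := by
    by_cases hd0 : d = 0
    · rw [hd0, coeff_C_zero, coeff_C_of_ne_zero (hdp.resolve_left (not_not.2 hd0))]
    · rw [coeff_C_of_ne_zero hd0, coeff_zero]
  rw [hz, add_zero, coeff_natDegree, mul_left_comm] at e2
  have e3 := (left_eq_mul₀ (leadingCoeff_ne_zero.2 hp0)).1 e2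
  ext
  rw [Units.val_pow_eq_pow_val, Units.val_one, ← e3, pow_add, pow_mul, mul_comm]

/-! ### Scalars and roots of unity -/

theorem mem_of_sigma_mul_tau_mem_polyRtimes {h r : k[X]} {a : scaling h} {G : Subgroup kˣ}
    (hρ : sigma h (.ofAdd r) * tau h a ∈ polyRtimes h G) : (a : kˣ) ∈ G := by
  obtain ⟨r', b, hb, e⟩ := (mem_polyRtimes h G _).1 hρ
  have hx := congrArg (fun f => toPoly h (f (A.x h))) e
  simp only [sigma_mul_tau_x] at hx
  rw [map_smul, map_smul, toPoly_x] at hx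
  have hab := smul_left_injective k (C_ne_zero.2 X_ne_zero : (C X : k[X][X]) ≠ 0) hx
  rwa [Units.ext hab]

theorem scaling_X_pow_eq_top {h : k[X]} (hh : h = X ^ h.natDegree) : scaling h = ⊤ := by
  refine eq_top_iff.2 fun a _ => ?_
  change h.comp (C (a : k) * X) = C ((a : k) ^ h.natDegree) * h
  conv_lhs => rw [hh]
  conv_rhs => rw [hh]
  rw [natDegree_X_pow, X_pow_comp, mul_pow, C_pow]

/-- If `h` has a second term, the scalars `a` with `h(ax) = a^N h(x)` form a finite group,
hence a group of roots of unity. -/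
theorem exists_scaling_eq_rootsOfUnity {h : k[X]} (hmonic : h.Monic) (hh : h ≠ X ^ h.natDegree) :
    ∃ n : ℕ, 1 ≤ n ∧ scaling h = rootsOfUnity n k := by
  obtain ⟨j, hj⟩ : ∃ j, h.coeff j ≠ (X ^ h.natDegree : k[X]).coeff j := by
    by_contra! hcon
    exact hh (Polynomial.ext hcon)
  rw [coeff_X_pow] at hj
  have hjN : j < h.natDegree := by
    rcases lt_trichotomy j h.natDegree with hlt | heq | hgt
    · exact hlt
    · exact absurd (by rw [if_pos heq, heq, hmonic.coeff_natDegree]) hj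
    · exact absurd (by rw [if_neg hgt.ne', coeff_eq_zero_of_natDegree_lt hgt]) hj
  rw [if_neg hjN.ne] at hj
  have hle : scaling h ≤ rootsOfUnity (h.natDegree - j) k := fun a ha => by
    have e : h.comp (C (a : k) * X) = C ((a : k) ^ h.natDegree) * h := ha
    have e2 := congrArg (fun q => q.coeff j) e
    rw [comp_C_mul_X_coeff, coeff_C_mul, mul_comm] at e2
    have e3 := mul_right_cancel₀ hj e2
    rw [mem_rootsOfUnity]
    ext
    rw [← Nat.add_sub_cancel' hjN.le, pow_add] at e3
    rw [Units.val_pow_eq_pow_val, Units.val_one]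
    exact ((left_eq_mul₀ (pow_ne_zero j a.ne_zero)).1 e3)
  have : NeZero (h.natDegree - j) := ⟨by omega⟩
  have : Finite (scaling h) := Finite.of_injective _ (Subgroup.inclusion_injective hle)
  have hpos : 0 < Nat.card (scaling h) := Nat.card_pos
  have : NeZero (Nat.card (scaling h)) := ⟨hpos.ne'⟩
  refine ⟨Nat.card (scaling h), hpos, Subgroup.eq_of_le_of_card_ge (fun a ha => ?_) ?_⟩
  · rw [mem_rootsOfUnity]
    exact congrArg Subtype.val (pow_card_eq_one' (x := (⟨a, ha⟩ : scaling h)))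
  · exact card_rootsOfUnity k _

theorem finite_multiplicativePart {h : k[X]} {H : Subgroup (A h ≃ₐ[k] A h)} {n : ℕ} (hn : 1 ≤ n)
    (hH : H ≤ polyRtimes h (rootsOfUnity n k)) : Finite (multiplicativePart h H) := by
  have : NeZero n := ⟨by omega⟩
  have hmem : ∀ a ∈ multiplicativePart h H, (a : kˣ) ∈ rootsOfUnity n k := by
    rintro _ ⟨g, hg, rfl⟩
    exact mem_of_sigma_mul_tau_mem_polyRtimes (r := g.left.toAdd) (hH hg)
  refine Finite.of_injective
    (fun a : multiplicativePart h H => (⟨a.1, hmem a.1 a.2⟩ : rootsOfUnity n k)) fun a b hab => ?_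
  exact Subtype.ext (Subtype.ext (congrArg (fun z : rootsOfUnity n k => (z : kˣ)) hab))

theorem polyRtimes_rootsOfUnity_ne_top [CharZero k] {h : k[X]} (hh : h = X ^ h.natDegree) {n : ℕ}
    (hn : 1 ≤ n) : polyRtimes h (rootsOfUnity n k) ≠ ⊤ := by
  intro htop
  -- The scalar `2` is not a root of unity.
  let a : scaling h := ⟨Units.mk0 2 two_ne_zero, by rw [scaling_X_pow_eq_top hh]; trivial⟩
  have ha : (a : kˣ) ∈ rootsOfUnity n k :=
    mem_of_sigma_mul_tau_mem_polyRtimes (r := 0) (htop ▸ Subgroup.mem_top _)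
  have h2 : ((2 : k)) ^ n = 1 := by
    simpa [a] using congrArg Units.val ((mem_rootsOfUnity n _).1 ha)
  have h3 : 2 ^ n = 1 := by exact_mod_cast h2
  exact (Nat.one_lt_two_pow (by omega)).ne' h3

end

end DiffOre

theorem mainTheorem5 {k : Type*} [Field k] [IsAlgClosed k] [CharZero k]
    (h : Polynomial k) (hdeg : 2 ≤ h.natDegree) (hmonic : h.Monic)
    (hcoeff : h.coeff (h.natDegree - 1) = 0)
    (w : DiffOre.A h) (hw : w ∉ Set.range (algebraMap k (DiffOre.A h)))
    (s : Polynomial k) (hs : s.degree < h.degree) :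
    (∃ n : ℕ, 1 ≤ n ∧ rootsOfUnity n k ≤ DiffOre.scaling h ∧
      DiffOre.isotropy (DiffOre.ad w + DiffOre.delta h s) ≤
        DiffOre.polyRtimes h (rootsOfUnity n k)) ∧
    Finite (DiffOre.multiplicativePart h
      (DiffOre.isotropy (DiffOre.ad w + DiffOre.delta h s))) ∧
    (h = Polynomial.X ^ h.natDegree →
      DiffOre.isotropy (DiffOre.ad w + DiffOre.delta h s) < ⊤) := by
  have main : ∃ n : ℕ, 1 ≤ n ∧ rootsOfUnity n k ≤ DiffOre.scaling h ∧
      DiffOre.isotropy (DiffOre.ad w + DiffOre.delta h s) ≤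
        DiffOre.polyRtimes h (rootsOfUnity n k) := by
    by_cases hh : h = Polynomial.X ^ h.natDegree
    · obtain ⟨n, hn, hpow⟩ := DiffOre.exists_pow_eq_one hdeg hw hs
      refine ⟨n, hn, by rw [DiffOre.scaling_X_pow_eq_top hh]; exact le_top, fun ρ hρ => ?_⟩
      obtain ⟨r, a, rfl⟩ := DiffOre.exists_eq_sigma_mul_tau hdeg hmonic hcoeff ρ
      exact (DiffOre.mem_polyRtimes _ _ _).2 ⟨r, a, hpow r a hρ, rfl⟩
    · obtain ⟨n, hn, hG⟩ := DiffOre.exists_scaling_eq_rootsOfUnity hmonic hh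
      refine ⟨n, hn, hG.ge, fun ρ _ => ?_⟩
      obtain ⟨r, a, rfl⟩ := DiffOre.exists_eq_sigma_mul_tau hdeg hmonic hcoeff ρ
      exact (DiffOre.mem_polyRtimes _ _ _).2 ⟨r, a, hG ▸ a.2, rfl⟩
  refine ⟨main, ?_, fun hh => ?_⟩
  · obtain ⟨n, hn, _, hle⟩ := main
    exact DiffOre.finite_multiplicativePart hn hle
  · obtain ⟨n, hn, _, hle⟩ := main
    exact hle.trans_lt (lt_top_iff_ne_top.2 (DiffOre.polyRtimes_rootsOfUnity_ne_top hh hn))
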